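/- Let $n,m,p\in\mathbb N$ and consider the linear time-invariant system $\Sigma$: $\dot x=Ax+Bu$, $x(0)=x_0$, $y=Cx+Du$, with real matrices $A\in\mathbb R^{n\times n}$, $B\in\mathbb R^{n\times m}$, $C\in\mathbb R^{p\times n}$, $D\in\mathbb R^{p\times m}$. Let $\mathcal U\subseteq\mathbb R^m$ and $\mathcal X\subseteq\mathbb R^n$ be arbitrary sets, and let $\mathfrak S$ be the system obtained from $\Sigma$ by imposing $u(t)\in\mathcal U$ and $x(t)\in\mathcal X$ for all $t\ge 0$. Inputs $u$ are causal (zero for $t<0$), piecewise continuous (finitely many discontinuities on each bounded interval, finite one-sided limits) and exponentially bounded; state trajectories are continuous, and outputs piecewise continuous, on $[0,\infty)$. The state equation is understood in integrated form, and equality of input signals and of output signals means equality at almost every $t\ge0$. For $x_0\in\mathbb R^n$ let $\mathbf Q(x_0)$ be the set of triples $(u,x,y)$ of such signals where $x$ is the state trajectory produced by $u$ from $x(0)=x_0$, $y=Cx+Du$, and $u(t)\in\mathcal U$, $x(t)\in\mathcal X$ for all $t\ge0$. A pair $(x_0,y)$, with $x_0\in\mathcal X$ and $y$ an output signal, is *admissible*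 for $\mathfrak S$ if $(u,x,y)\in\mathbf Q(x_0)$ for some $(u,x)$, and *input redundant* for $\mathfrak S$ if there are $(u_1,x_1,y_1),(u_2,x_2,y_2)\in\mathbf Q(x_0)$ with $u_1\ne u_2$ (that is, $u_1$ and $u_2$ differ on a set of positive measure) and $y_1=y_2=y$. The unconstrained system $\Sigma$ is *input redundant* if, for $\mathcal U=\mathbb R^m$ and $\mathcal X=\mathbb R^n$, some pair $(x_0,y)$ is input redundant. **Theorem.** Let $\rho=\dim(\ker B\cap\ker D)$ and assume that the unconstrained system $\Sigma$ is input redundant. Let $(x_0,y)$ be an admissible pair for $\mathfrak S$, and suppose that there exist $(u,x)$ and $0\le t_0<t_f$ such that $(u,x,y)\in\mathbf Q(x_0)$ and - if $\rho>0$, then $u(t)\in\operatorname{int}(\mathcal U)$ for all $t\in\,]t_0,t_f[$; - if $\rho=0$, then $u(t)\in\operatorname{int}(\mathcal U)$ and $x(t)\in\operatorname{int}(\mathcal X)$ for all $t\in\,]t_0,t_f[$. Then $(x_0,y)$ is input redundant for $\mathfrak S$. -/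

import Mathlib

open Set Filter Topology MeasureTheory
open scoped Matrix

/-- The linear time-invariant system `x' = A x + B u`, `y = C x + D u` with `m` inputs, `n` states
and `p` outputs. -/
structure LTISystem (n m p : ℕ) where
  A : Matrix (Fin n) (Fin n) ℝ
  B : Matrix (Fin n) (Fin m) ℝ
  C : Matrix (Fin p) (Fin n) ℝ
  D : Matrix (Fin p) (Fin m) ℝ

/-- Signals live on the time set `[0, ∞)`. They are represented by functions on `ℝ` of which only
the values on `[0, ∞)` matter (inputs are moreover required to vanish for negative times). -/
abbrev Signal (k : ℕ) : Type := ℝ → (Fin k → ℝ)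

/-- Equality of signals: equality at almost every time of `[0, ∞)`. -/
def SignalEq {k : ℕ} (f g : Signal k) : Prop :=
  ∀ᵐ t ∂(volume.restrict (Ici (0 : ℝ))), f t = g t

/-- Piecewise continuity on `[0, ∞)`: finitely many discontinuities on every bounded interval,
and finite one-sided limits everywhere. -/
def PiecewiseContinuous {k : ℕ} (f : Signal k) : Prop :=
  (∀ T : ℝ, {t ∈ Icc 0 T | ¬ ContinuousWithinAt f (Ici 0) t}.Finite) ∧
  (∀ t : ℝ, 0 < t → ∃ l, Tendsto f (𝓝[<] t) (𝓝 l)) ∧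
  (∀ t : ℝ, 0 ≤ t → ∃ l, Tendsto f (𝓝[>] t) (𝓝 l))

/-- Unconstrained input space: causal, piecewise continuous, exponentially bounded signals. -/
def inputSpace (m : ℕ) : Set (Signal m) :=
  {u | (∀ t < 0, u t = 0) ∧ PiecewiseContinuous u ∧
    ∃ M a : ℝ, ∀ t, 0 ≤ t → ‖u t‖ ≤ M * Real.exp (a * t)}

/-- Unconstrained state space of signals: continuous functions on `[0, ∞)`. -/
def stateSpace (n : ℕ) : Set (Signal n) := {x | ContinuousOn x (Ici 0)}

/-- Output signals: piecewise continuous functions on `[0, ∞)`. -/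
def outputSpace (p : ℕ) : Set (Signal p) := {y | PiecewiseContinuous y}

/-- Inputs satisfying the constraint `u(t) ∈ U` at every time `t ≥ 0`. -/
def constrainedInputs {m : ℕ} (U : Set (Fin m → ℝ)) : Set (Signal m) :=
  {u | ∀ t, 0 ≤ t → u t ∈ U} ∩ inputSpace m

/-- State signals satisfying the constraint `x(t) ∈ X` at every time `t ≥ 0`. -/
def constrainedStates {n : ℕ} (X : Set (Fin n → ℝ)) : Set (Signal n) :=
  {x | ∀ t, 0 ≤ t → x t ∈ X} ∩ stateSpace n

namespace LTISystem

variable {n m p : ℕ}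

/-- `x` is the state trajectory produced by the input `u` from the initial state `x₀`: the
solution of `x' = A x + B u`, `x(0) = x₀`. As `u` is only piecewise continuous, the differential
equation is understood in integrated form. -/
def IsStateTrajectory (S : LTISystem n m p) (x₀ : Fin n → ℝ) (u : Signal m) (x : Signal n) :
    Prop :=
  ∀ t, 0 ≤ t → x t = x₀ + ∫ s in (0 : ℝ)..t, (S.A *ᵥ x s + S.B *ᵥ u s)

/-- Triples `(u, x, y)` compatible for `x₀` with the unconstrained system. -/
def unconstrainedTriples (S : LTISystem n m p) (x₀ : Fin n → ℝ) :
    Set (Signal m × Signal n × Signal p) :=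
  {q | q.1 ∈ inputSpace m ∧ q.2.1 ∈ stateSpace n ∧ q.2.2 ∈ outputSpace p ∧
    S.IsStateTrajectory x₀ q.1 q.2.1 ∧
    SignalEq q.2.2 (fun t => S.C *ᵥ q.2.1 t + S.D *ᵥ q.1 t)}

/-- Triples `(u, x, y)` compatible for `x₀` with the system subject to the input constraint set
`U` and the state constraint set `X`. -/
def triples (S : LTISystem n m p) (U : Set (Fin m → ℝ)) (X : Set (Fin n → ℝ))
    (x₀ : Fin n → ℝ) : Set (Signal m × Signal n × Signal p) :=
  S.unconstrainedTriples x₀ ∩ (constrainedInputs U ×ˢ constrainedStates X ×ˢ outputSpace p)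

/-- Input-output pairs `(u, y)` compatible for `x₀` with the constrained system. -/
def pairs (S : LTISystem n m p) (U : Set (Fin m → ℝ)) (X : Set (Fin n → ℝ))
    (x₀ : Fin n → ℝ) : Set (Signal m × Signal p) :=
  {w | ∃ x, (w.1, x, w.2) ∈ S.triples U X x₀}

/-- The set of admissible pairs `(x₀, y)` of the constrained system. -/
def admissiblePairs (S : LTISystem n m p) (U : Set (Fin m → ℝ)) (X : Set (Fin n → ℝ)) :
    Set ((Fin n → ℝ) × Signal p) :=
  {z | z ∈ X ×ˢ outputSpace p ∧ ∃ u, (u, z.2) ∈ S.pairs U X z.1}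

/-- The set of input redundant pairs `(x₀, y)` of the constrained system: `y` is produced from
`x₀` by two distinct inputs. -/
def redundantPairs (S : LTISystem n m p) (U : Set (Fin m → ℝ)) (X : Set (Fin n → ℝ)) :
    Set ((Fin n → ℝ) × Signal p) :=
  {z | z ∈ X ×ˢ outputSpace p ∧
    ∃ u₁ y₁ u₂ y₂, (u₁, y₁) ∈ S.pairs U X z.1 ∧ (u₂, y₂) ∈ S.pairs U X z.1 ∧
      ¬ SignalEq u₁ u₂ ∧ SignalEq y₁ y₂ ∧ SignalEq y₂ z.2}

/-- The constrained system is input redundant if it has an input redundant pair. -/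
def IsInputRedundant (S : LTISystem n m p) (U : Set (Fin m → ℝ)) (X : Set (Fin n → ℝ)) : Prop :=
  (S.redundantPairs U X).Nonempty

/-- `ρ = dim (ker B ∩ ker D)`. -/
noncomputable def rho (S : LTISystem n m p) : ℕ :=
  Module.finrank ℝ ↥(LinearMap.ker S.B.mulVecLin ⊓ LinearMap.ker S.D.mulVecLin)

end LTISystem

/-!
By superposition, two inputs with the same output differ by a nonzero input that produces output
zero from the initial state zero. Its primitives are continuous and have the same property, so they
solve the linear system `ξ = J (A ξ + B ω)`, `C ξ + D ω = 0`, where `J` is integration from `0`.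
This is a system over `ℝ[X]` with unknowns in `C(ℝ, ℝ)`, on which `X` acts as `J`. As nonzero
polynomials in `J` are injective, `C(ℝ, ℝ)` is a torsion-free `ℝ[X]`-module, and a linear functional
on the free submodule generated by the unknowns turns the solution into one by polynomials
`P j`, `Q i` with `P ≠ 0`.

Now take a high derivative `f` of a bump function in the time window: all the iterated primitives
`J ^ k f` that occur are supported in the window, and so are the input `P(J) f` and the state
`Q(J) f`, which produce the output zero. If `ρ > 0`, a bump function times a vector of
`ker B ∩ ker D` does the same with state zero. In both cases a small multiple of the resulting pulse
can be added to `(u, x)` without leaving the constraint sets.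
-/

open scoped Polynomial

theorem eventually_forall_add_smul_mem {T E : Type*} [TopologicalSpace T] [TopologicalSpace E]
    [AddCommGroup E] [Module ℝ E] [ContinuousAdd E] [ContinuousSMul ℝ E] {K : Set T} {U : Set E}
    {u v : T → E} (hK : IsCompact K) (hu : ContinuousOn u K) (hv : ContinuousOn v K)
    (hU : ∀ t ∈ K, u t ∈ interior U) : ∀ᶠ c in 𝓝 (0 : ℝ), ∀ t ∈ K, u t + c • v t ∈ U := by
  have hsub : ∀ᶠ c in 𝓝 (0 : ℝ), ∀ t ∈ (univ : Set K), u t + c • v t ∈ U := by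
    refine (isCompact_iff_isCompact_univ.1 hK).eventually_forall_of_forall_eventually fun t _ => ?_
    have hcont : Continuous fun q : ℝ × K => u q.2 + q.1 • v q.2 :=
      (hu.domRestrict.comp continuous_snd).add
        (continuous_fst.smul (hv.domRestrict.comp continuous_snd))
    refine hcont.continuousAt.preimage_mem_nhds (mem_interior_iff_mem_nhds.1 ?_)
    simpa using hU t t.2
  exact hsub.mono fun c hc t ht => hc ⟨t, ht⟩ (mem_univ _)

section Volterra

variable {E : Type*} [NormedAddCommGroup E] [NormedSpace ℝ E]

variable (E) in
/-- The Volterra operator `J`, integration from `0`, on the continuous functions on `ℝ`. -/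
noncomputable def volterra : Module.End ℝ C(ℝ, E) where
  toFun f := ⟨fun t => ∫ s in (0 : ℝ)..t, f s,
    intervalIntegral.continuous_primitive (fun _ _ => f.continuous.intervalIntegrable _ _) 0⟩
  map_add' f g := by
    ext t
    exact intervalIntegral.integral_add (f.continuous.intervalIntegrable _ _)
      (g.continuous.intervalIntegrable _ _)
  map_smul' c f := by
    ext t
    exact intervalIntegral.integral_smul c _

theorem volterra_apply (f : C(ℝ, E)) (t : ℝ) : volterra E f t = ∫ s in (0 : ℝ)..t, f s := rfl

theorem volterra_deriv [CompleteSpace E] {f : C(ℝ, E)} (hf : ContDiff ℝ 1 f) (hf0 : f 0 = 0) :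
    volterra E ⟨deriv f, hf.continuous_deriv le_rfl⟩ = f := by
  ext t
  rw [volterra_apply, ContinuousMap.coe_mk, intervalIntegral.integral_deriv_eq_sub
    (fun x _ => hf.differentiable one_ne_zero x)
    ((hf.continuous_deriv le_rfl).intervalIntegrable _ _), hf0, sub_zero]

theorem aeval_volterra_apply_eq_zero {k : ℕ} {t : ℝ} {f : C(ℝ, E)}
    (hf : ∀ j ≤ k, (volterra E ^ j) f t = 0) {p : ℝ[X]} (hp : p.natDegree ≤ k) :
    Polynomial.aeval (volterra E) p f t = 0 := by
  rw [Polynomial.aeval_eq_sum_range, LinearMap.sum_apply, ContinuousMap.sum_apply]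
  refine Finset.sum_eq_zero fun j hj => ?_
  have hjk : j ≤ k := (Finset.mem_range_succ_iff.1 hj).trans hp
  simp [hf j hjk]

variable [CompleteSpace E]

theorem hasDerivAt_volterra (f : C(ℝ, E)) (t : ℝ) : HasDerivAt (volterra E f) (f t) t :=
  (f.continuous.integral_hasStrictDerivAt 0 t).hasDerivAt

theorem volterra_injective : Function.Injective (volterra E) := by
  intro f g h
  ext t
  exact (hasDerivAt_volterra f t).unique (h ▸ hasDerivAt_volterra g t)

theorem eq_zero_of_eq_volterra_sum {ι : Type*} [Fintype ι] (M : Matrix ι ι ℝ) (F : ι → C(ℝ, E))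
    (hF : ∀ i, F i = volterra E (∑ j, M i j • F j)) : F = 0 := by
  let L : (ι → E) →L[ℝ] (ι → E) :=
    ContinuousLinearMap.pi fun i => ∑ j, M i j • ContinuousLinearMap.proj j
  have hderiv (t : ℝ) : HasDerivAt (fun t i => F i t) (L fun i => F i t) t := by
    refine hasDerivAt_pi.2 fun i => ?_
    have := hasDerivAt_volterra (∑ j, M i j • F j) t
    rw [← hF i] at this
    simpa [L] using this
  have hinit (i : ι) : F i 0 = 0 := by rw [hF i, volterra_apply, intervalIntegral.integral_same]
  have hzero : (fun t i => F i t) = fun (_ : ℝ) (_ : ι) => (0 : E) :=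
    ODE_solution_unique_univ (v := fun _ => L) (s := fun _ => univ) (t₀ := 0)
      (fun _ => L.lipschitz.lipschitzOnWith) (fun t => ⟨hderiv t, mem_univ _⟩)
      (fun t => ⟨(hasDerivAt_const t _).congr_deriv (map_zero L).symm, mem_univ _⟩) (funext hinit)
  ext i t
  exact congrFun (congrFun hzero t) i

-- `J` is invertible on `W`, so a basis of `W` solves a homogeneous linear differential equation
-- with zero initial value.
theorem eq_bot_of_volterra_mem (W : Submodule ℝ C(ℝ, E)) [FiniteDimensional ℝ W]
    (hW : ∀ f ∈ W, volterra E f ∈ W) : W = ⊥ := by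
  let T : W →ₗ[ℝ] W := (volterra E).restrict hW
  have hT : Function.Surjective T := LinearMap.surjective_of_injective fun f g h =>
    Subtype.ext (volterra_injective (congrArg Subtype.val h))
  choose D hD using hT
  let b := Module.finBasis ℝ W
  have hb : (fun i => (b i : C(ℝ, E))) = 0 := by
    refine eq_zero_of_eq_volterra_sum (Matrix.of fun i j => b.repr (D (b i)) j) _ fun i => ?_
    calc (b i : C(ℝ, E)) = T (D (b i)) := by rw [hD]
      _ = volterra E ((∑ j, b.repr (D (b i)) j • b j : W) : C(ℝ, E)) := by
        rw [b.sum_repr]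
        rfl
      _ = _ := by simp only [Submodule.coe_sum, Submodule.coe_smul, Matrix.of_apply]
  refine (Submodule.eq_bot_iff W).2 fun f hf => ?_
  have hid : (LinearMap.id : W →ₗ[ℝ] W) = 0 := b.ext fun i => Subtype.ext (congrFun hb i)
  exact congrArg Subtype.val (LinearMap.congr_fun hid ⟨f, hf⟩)

-- Reduction modulo `p` shows that the span of all `J ^ k f` is finite-dimensional.
theorem eq_zero_of_aeval_volterra_eq_zero {p : ℝ[X]} (hp : p ≠ 0) {f : C(ℝ, E)}
    (hf : Polynomial.aeval (volterra E) p f = 0) : f = 0 := by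
  let φ : ℝ[X] →ₗ[ℝ] C(ℝ, E) :=
    (LinearMap.applyₗ f).comp (Polynomial.aeval (volterra E)).toLinearMap
  have hφ (q : ℝ[X]) : φ q = Polynomial.aeval (volterra E) q f := rfl
  have hmod (q : ℝ[X]) : φ (q % p) = φ q := by
    conv_rhs => rw [← EuclideanDomain.mod_add_div q p, mul_comm p, map_add]
    simp [hφ, hf]
  have hle : φ.range ≤ (Polynomial.degreeLT ℝ p.natDegree).map φ := by
    rintro _ ⟨q, rfl⟩
    refine ⟨q % p, Polynomial.mem_degreeLT.2 ?_, hmod q⟩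
    rw [← Polynomial.degree_eq_natDegree hp]
    exact Polynomial.degree_mod_lt q hp
  have := Submodule.finiteDimensional_of_le hle
  have hbot : φ.range = ⊥ := eq_bot_of_volterra_mem _ <| by
    rintro _ ⟨q, rfl⟩
    exact ⟨Polynomial.X * q, by simp [hφ]⟩
  simpa [hφ] using (Submodule.eq_bot_iff _).1 hbot _ ⟨1, rfl⟩

instance isTorsionFree_aeval_volterra :
    Module.IsTorsionFree ℝ[X] (Module.AEval' (volterra E)) := by
  refine .of_smul_eq_zero fun p e h => or_iff_not_imp_left.2 fun hp => ?_
  obtain ⟨f, rfl⟩ := (Module.AEval'.of (volterra E)).surjective e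
  rw [← Module.AEval.of_aeval_smul, EmbeddingLike.map_eq_zero_iff] at h
  rw [eq_zero_of_aeval_volterra_eq_zero hp h, map_zero]

theorem exists_volterra_pow_supported {K : Set ℝ} (hK : (interior K).Nonempty) (h0 : 0 ∉ K)
    (k : ℕ) : ∃ f : C(ℝ, ℝ), f ≠ 0 ∧ ∀ j ≤ k, ∀ t ∉ K, (volterra ℝ ^ j) f t = 0 := by
  suffices h : ∃ f : C(ℝ, ℝ), f ≠ 0 ∧ ContDiff ℝ (⊤ : ℕ∞) f ∧
      ∀ j ≤ k, tsupport ((volterra ℝ ^ j) f) ⊆ K by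
    obtain ⟨f, hf, -, hsupp⟩ := h
    exact ⟨f, hf, fun j hj t ht => image_eq_zero_of_notMem_tsupport fun h => ht (hsupp j hj h)⟩
  induction k with
  | zero =>
    obtain ⟨c, hc⟩ := hK
    obtain ⟨f, hsupp, -, hsmooth, -, hfc⟩ :=
      exists_contDiff_tsupport_subset (n := ⊤) (mem_interior_iff_mem_nhds.1 hc)
    refine ⟨⟨f, hsmooth.continuous⟩, fun h => ?_, hsmooth, fun j hj => ?_⟩
    · exact one_ne_zero (hfc.symm.trans (DFunLike.congr_fun h c))
    · simpa [Nat.le_zero.1 hj] using hsupp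
  | succ k ih =>
    obtain ⟨f, hf, hsmooth, hsupp⟩ := ih
    have hf0 : f 0 = 0 := image_eq_zero_of_notMem_tsupport fun h => h0 (hsupp 0 k.zero_le h)
    have hJ := volterra_deriv (hsmooth.of_le (by simp)) hf0
    have hsmooth' : ContDiff ℝ (⊤ : ℕ∞) (deriv f) := ContDiff.deriv' (by simpa using hsmooth)
    refine ⟨⟨deriv f, hsmooth'.continuous⟩, fun h => hf ?_, hsmooth', fun j hj => ?_⟩
    · rw [← hJ, h, map_zero]
    · rcases j with _ | j
      · exact tsupport_deriv_subset.trans (hsupp 0 k.zero_le)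
      · rw [pow_succ, Module.End.mul_apply, hJ]
        exact hsupp j (Nat.le_of_succ_le_succ hj)

end Volterra

section Signals

variable {k : ℕ}

theorem PiecewiseContinuous.add_smul {f g : Signal k} (hf : PiecewiseContinuous f)
    (hg : PiecewiseContinuous g) (c : ℝ) : PiecewiseContinuous (f + c • g) := by
  obtain ⟨hf_fin, hf_left, hf_right⟩ := hf
  obtain ⟨hg_fin, hg_left, hg_right⟩ := hg
  refine ⟨fun T => ((hf_fin T).union (hg_fin T)).subset ?_, fun t ht => ?_, fun t ht => ?_⟩
  · rintro t ⟨hT, hdisc⟩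
    by_contra! hcont
    simp only [mem_union, mem_ofPred_eq, hT, true_and, not_or, not_not] at hcont
    exact hdisc (hcont.1.add (hcont.2.const_smul c))
  · obtain ⟨l, hl⟩ := hf_left t ht
    obtain ⟨l', hl'⟩ := hg_left t ht
    exact ⟨_, hl.add (hl'.const_smul c)⟩
  · obtain ⟨l, hl⟩ := hf_right t ht
    obtain ⟨l', hl'⟩ := hg_right t ht
    exact ⟨_, hl.add (hl'.const_smul c)⟩

theorem piecewiseContinuous_of_continuous {f : Signal k} (hf : Continuous f) :
    PiecewiseContinuous f := by
  refine ⟨fun T => ?_, fun t _ => ⟨f t, hf.continuousWithinAt⟩,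
    fun t _ => ⟨f t, hf.continuousWithinAt⟩⟩
  simp [hf.continuousWithinAt]

theorem PiecewiseContinuous.aestronglyMeasurable {f : Signal k} (hf : PiecewiseContinuous f)
    (T : ℝ) : AEStronglyMeasurable f (volume.restrict (Icc 0 T)) := by
  have hfin := hf.1 T
  set F := {t ∈ Icc 0 T | ¬ ContinuousWithinAt f (Ici 0) t}
  rw [← Measure.restrict_congr_set (sdiff_null_ae_eq_self (hfin.measure_zero volume))]
  refine ContinuousOn.aestronglyMeasurable (fun t ht => ?_)
    (measurableSet_Icc.diff hfin.measurableSet)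
  have hcont : ContinuousWithinAt f (Ici 0) t := by
    by_contra h
    exact ht.2 ⟨ht.1, h⟩
  exact hcont.mono fun s hs => hs.1.1

theorem PiecewiseContinuous.exists_isCompact_continuousOn {f : Signal k}
    (hf : PiecewiseContinuous f) {a b : ℝ} (ha : 0 ≤ a) (hab : a < b) :
    ∃ K ⊆ Ioo a b, IsCompact K ∧ (interior K).Nonempty ∧ ContinuousOn f K := by
  have hfin := hf.1 b
  set F := {t ∈ Icc 0 b | ¬ ContinuousWithinAt f (Ici 0) t}
  obtain ⟨c, hc⟩ : (Ioo a b \ F).Nonempty := ((Ioo_infinite hab).sdiff hfin).nonempty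
  obtain ⟨K, hK, hcK, hKsub⟩ := exists_compact_subset (isOpen_Ioo.sdiff hfin.isClosed) hc
  have hpos (t : ℝ) (ht : t ∈ K) : 0 ≤ t := ha.trans (hKsub ht).1.1.le
  refine ⟨K, fun t ht => (hKsub ht).1, hK, ⟨c, hcK⟩, fun t ht => ?_⟩
  have hcont : ContinuousWithinAt f (Ici 0) t := by
    by_contra h
    exact (hKsub ht).2 ⟨⟨hpos t ht, (hKsub ht).1.2.le⟩, h⟩
  exact hcont.mono hpos

theorem add_smul_mem_inputSpace {u v : Signal k} (hu : u ∈ inputSpace k) (hv : v ∈ inputSpace k)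
    (c : ℝ) : u + c • v ∈ inputSpace k := by
  obtain ⟨hu_neg, hu_pc, M, a, hM⟩ := hu
  obtain ⟨hv_neg, hv_pc, N, b, hN⟩ := hv
  refine ⟨fun t ht => by simp [hu_neg t ht, hv_neg t ht], hu_pc.add_smul hv_pc c,
    |M| + |c| * |N|, max a b, fun t ht => ?_⟩
  calc ‖u t + c • v t‖ ≤ ‖u t‖ + |c| * ‖v t‖ := by
        simpa only [norm_smul, Real.norm_eq_abs] using norm_add_le (u t) (c • v t)
    _ ≤ |M| * Real.exp (max a b * t) + |c| * (|N| * Real.exp (max a b * t)) := by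
        gcongr
        · refine (hM t ht).trans ?_
          gcongr
          exacts [le_abs_self M, le_max_left a b]
        · refine (hN t ht).trans ?_
          gcongr
          exacts [le_abs_self N, le_max_right a b]
    _ = (|M| + |c| * |N|) * Real.exp (max a b * t) := by ring

theorem mem_inputSpace_of_hasCompactSupport {u : Signal k} (hu : Continuous u)
    (hcs : HasCompactSupport u) (hneg : ∀ t < 0, u t = 0) : u ∈ inputSpace k := by
  obtain ⟨M, hM⟩ := hu.bounded_above_of_compact_support hcs
  exact ⟨hneg, piecewiseContinuous_of_continuous hu, M, 0, fun t _ => by simpa using hM t⟩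

theorem locallyIntegrable_of_mem_inputSpace {u : Signal k} (hu : u ∈ inputSpace k) :
    LocallyIntegrable u volume := by
  obtain ⟨hneg, hpc, M, a, hM⟩ := hu
  refine locallyIntegrable_iff.2 fun K hK => ?_
  obtain ⟨T, hT⟩ := hK.bddAbove
  have hIio : IntegrableOn u (Iio 0) :=
    integrableOn_zero.congr_fun (fun t ht => (hneg t ht).symm) measurableSet_Iio
  have hIcc : IntegrableOn u (Icc 0 T) := by
    have hexp : IntegrableOn (fun t => M * Real.exp (a * t)) (Icc 0 T) :=
      Continuous.integrableOn_Icc (by fun_prop)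
    refine hexp.mono' (hpc.aestronglyMeasurable T) ?_
    filter_upwards [ae_restrict_mem measurableSet_Icc] with t ht using hM t ht.1
  refine (hIio.union hIcc).mono_set fun t ht => ?_
  exact (lt_or_ge t 0).imp id fun h => ⟨h, hT ht⟩

end Signals

theorem intervalIntegrable_of_locallyIntegrable {E : Type*} [NormedAddCommGroup E] {f : ℝ → E}
    {μ : Measure ℝ} (hf : LocallyIntegrable f μ) (a b : ℝ) : IntervalIntegrable f μ a b :=
  (hf.integrableOn_isCompact isCompact_uIcc).intervalIntegrable

section MulVec

variable {ι κ ν : Type*} [Fintype ι] [Fintype κ] [Fintype ν] {μ : Measure ℝ} {f : ℝ → κ → ℝ}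
  {g : ℝ → ν → ℝ} {a b : ℝ}

theorem intervalIntegrable_mulVec (M : Matrix ι κ ℝ)
    (hf : IntervalIntegrable f μ a b) :
    IntervalIntegrable (fun t => M *ᵥ f t) μ a b :=
  let L := M.mulVecLin.toContinuousLinearMap
  ⟨L.integrable_comp hf.1, L.integrable_comp hf.2⟩

theorem intervalIntegral_mulVec (M : Matrix ι κ ℝ)
    (hf : IntervalIntegrable f μ a b) :
    ∫ t in a..b, M *ᵥ f t ∂μ = M *ᵥ ∫ t in a..b, f t ∂μ :=
  M.mulVecLin.toContinuousLinearMap.intervalIntegral_comp_comm hf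

theorem intervalIntegral_mulVec_add_mulVec (M : Matrix ι κ ℝ)
    (N : Matrix ι ν ℝ) (hf : IntervalIntegrable f μ a b)
    (hg : IntervalIntegrable g μ a b) :
    ∫ t in a..b, (M *ᵥ f t + N *ᵥ g t) ∂μ =
      M *ᵥ (∫ t in a..b, f t ∂μ) + N *ᵥ ∫ t in a..b, g t ∂μ := by
  rw [intervalIntegral.integral_add (intervalIntegrable_mulVec M hf)
    (intervalIntegrable_mulVec N hg), intervalIntegral_mulVec M hf, intervalIntegral_mulVec N hg]

end MulVec

namespace LTISystem

variable {n m p : ℕ} {S : LTISystem n m p}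

section Superposition

variable {x₀ x₁ : Fin n → ℝ} {u v : Signal m} {x z : Signal n} {y w : Signal p}

theorem IsStateTrajectory.add_smul (h : S.IsStateTrajectory x₀ u x)
    (h' : S.IsStateTrajectory x₁ v z) (hu : u ∈ inputSpace m) (hx : x ∈ stateSpace n)
    (hv : v ∈ inputSpace m) (hz : z ∈ stateSpace n) (c : ℝ) :
    S.IsStateTrajectory (x₀ + c • x₁) (u + c • v) (x + c • z) := by
  intro t ht
  have hinput {f : Signal m} (hf : f ∈ inputSpace m) : IntervalIntegrable f volume 0 t :=
    intervalIntegrable_of_locallyIntegrable (locallyIntegrable_of_mem_inputSpace hf) 0 t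
  have hstate {g : Signal n} (hg : g ∈ stateSpace n) : IntervalIntegrable g volume 0 t :=
    (hg.mono (uIcc_of_le ht ▸ Icc_subset_Ici_self)).intervalIntegrable
  have hdyn {f : Signal m} {g : Signal n} (hf : f ∈ inputSpace m) (hg : g ∈ stateSpace n) :
      IntervalIntegrable (fun s => S.A *ᵥ g s + S.B *ᵥ f s) volume 0 t :=
    (intervalIntegrable_mulVec _ (hstate hg)).add (intervalIntegrable_mulVec _ (hinput hf))
  have hsmul : IntervalIntegrable (fun s => c • (S.A *ᵥ z s + S.B *ᵥ v s)) volume 0 t :=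
    (hdyn hv hz).smul c
  calc x t + c • z t
      = x₀ + c • x₁ + ((∫ s in (0 : ℝ)..t, (S.A *ᵥ x s + S.B *ᵥ u s)) +
          ∫ s in (0 : ℝ)..t, c • (S.A *ᵥ z s + S.B *ᵥ v s)) := by
        rw [h t ht, h' t ht, intervalIntegral.integral_smul]
        module
    _ = x₀ + c • x₁ +
          ∫ s in (0 : ℝ)..t, (S.A *ᵥ (x + c • z) s + S.B *ᵥ (u + c • v) s) := by
        rw [← intervalIntegral.integral_add (hdyn hu hx) hsmul]
        simp only [Pi.add_apply, Pi.smul_apply, Matrix.mulVec_add, Matrix.mulVec_smul, smul_add,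
          add_add_add_comm]

theorem add_smul_mem_unconstrainedTriples (h : (u, x, y) ∈ S.unconstrainedTriples x₀)
    (h' : (v, z, w) ∈ S.unconstrainedTriples x₁) (c : ℝ) :
    (u + c • v, x + c • z, y + c • w) ∈ S.unconstrainedTriples (x₀ + c • x₁) := by
  obtain ⟨hu, hx, hy, htraj, hout⟩ := h
  obtain ⟨hv, hz, hw, htraj', hout'⟩ := h'
  refine ⟨add_smul_mem_inputSpace hu hv c, hx.add (hz.const_smul c), hy.add_smul hw c,
    htraj.add_smul htraj' hu hx hv hz c, ?_⟩
  filter_upwards [hout, hout'] with t ht ht'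
  simp only [Pi.add_apply, Pi.smul_apply, ht, ht', Matrix.mulVec_add, Matrix.mulVec_smul]
  module

end Superposition

section NullTrajectory

variable {v : Signal m} {z : Signal n}

/-- The input `v` and the state `z` it produces from `z 0 = 0` yield the output zero. The time set
is all of `ℝ`, so that the components of `v` and `z` can be acted on by `volterra ℝ`. -/
structure IsNullTrajectory (S : LTISystem n m p) (v : Signal m) (z : Signal n) : Prop where
  state_eq : ∀ t, z t = ∫ s in (0 : ℝ)..t, (S.A *ᵥ z s + S.B *ᵥ v s)
  output_eq_zero : ∀ᵐ t, S.C *ᵥ z t + S.D *ᵥ v t = 0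

theorem isNullTrajectory_of_mem_unconstrainedTriples {w : Signal p}
    (h : (v, z, w) ∈ S.unconstrainedTriples 0) (hw : SignalEq w 0) :
    S.IsNullTrajectory v fun t => z (max t 0) := by
  obtain ⟨⟨hv, -⟩, -, -, htraj, hout⟩ := h
  have hz0 : z 0 = 0 := by simpa using htraj 0 le_rfl
  have hneg (t : ℝ) (ht : t < 0) : z (max t 0) = 0 ∧ v t = 0 := by
    rw [max_eq_right ht.le]
    exact ⟨hz0, hv t ht⟩
  refine ⟨fun t => ?_, ?_⟩
  · rcases le_or_gt 0 t with ht | ht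
    · rw [max_eq_left ht]
      refine (htraj t ht).trans ((zero_add _).trans ?_)
      refine intervalIntegral.integral_congr fun s hs => ?_
      rw [uIcc_of_le ht] at hs
      simp only [max_eq_left hs.1]
    · rw [(hneg t ht).1, intervalIntegral.integral_symm, eq_comm, neg_eq_zero]
      refine intervalIntegral.integral_zero_ae ?_
      filter_upwards [Measure.ae_ne volume 0] with s hs0 hs
      rw [uIoc_of_le ht.le] at hs
      simp [hneg s (hs.2.lt_of_ne hs0)]
  · filter_upwards [(ae_restrict_iff' measurableSet_Ici).1 hout,
      (ae_restrict_iff' measurableSet_Ici).1 hw] with t hout hw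
    rcases le_or_gt 0 t with ht | ht
    · rw [max_eq_left ht, ← hout ht, hw ht, Pi.zero_apply]
    · simp [hneg t ht]

theorem IsNullTrajectory.primitive (h : S.IsNullTrajectory v z)
    (hv : LocallyIntegrable v volume) (hz : Continuous z) :
    S.IsNullTrajectory (fun t => ∫ s in (0 : ℝ)..t, v s) fun t => ∫ s in (0 : ℝ)..t, z s := by
  have hintegral {q : ℕ} (M : Matrix (Fin q) (Fin n) ℝ) (N : Matrix (Fin q) (Fin m) ℝ) (t : ℝ) :=
    intervalIntegral_mulVec_add_mulVec M N (hz.intervalIntegrable 0 t)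
      (intervalIntegrable_of_locallyIntegrable hv 0 t)
  refine ⟨fun t => ?_, .of_forall fun t => ?_⟩
  · simp only [← hintegral, ← h.state_eq]
  · rw [← hintegral]
    exact intervalIntegral.integral_zero_ae (h.output_eq_zero.mono fun s hs _ => hs)

theorem IsInputRedundant.exists_isNullTrajectory {U : Set (Fin m → ℝ)} {X : Set (Fin n → ℝ)}
    (h : S.IsInputRedundant U X) : ∃ v z, S.IsNullTrajectory v z ∧
      LocallyIntegrable v volume ∧ Continuous z ∧ ¬ v =ᵐ[volume] 0 := by
  obtain ⟨⟨x₀, y⟩, -, u₁, y₁, u₂, y₂, ⟨x₁, h₁, -⟩, ⟨x₂, h₂, -⟩, hu, hy, -⟩ := h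
  have hdiff := add_smul_mem_unconstrainedTriples h₁ h₂ (-1)
  rw [neg_one_smul ℝ x₀, add_neg_cancel] at hdiff
  have hy_zero : SignalEq (y₁ + (-1 : ℝ) • y₂) 0 := by
    filter_upwards [hy] with t ht
    simp [ht]
  have hx : ContinuousOn (x₁ + (-1 : ℝ) • x₂) (Ici 0) := hdiff.2.1
  refine ⟨_, _, isNullTrajectory_of_mem_unconstrainedTriples hdiff hy_zero,
    locallyIntegrable_of_mem_inputSpace hdiff.1,
    hx.comp_continuous (by fun_prop) fun t => le_max_right t 0, fun hzero => hu ?_⟩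
  filter_upwards [ae_restrict_of_ae hzero] with t ht
  simpa [← sub_eq_add_neg, sub_eq_zero] using ht

theorem IsInputRedundant.exists_continuous_isNullTrajectory {U : Set (Fin m → ℝ)}
    {X : Set (Fin n → ℝ)} (h : S.IsInputRedundant U X) :
    ∃ v z, S.IsNullTrajectory v z ∧ Continuous v ∧ Continuous z ∧ v ≠ 0 := by
  obtain ⟨v, z, hvz, hv, hz, hv0⟩ := h.exists_isNullTrajectory
  refine ⟨_, _, hvz.primitive hv hz,
    intervalIntegral.continuous_primitive (intervalIntegrable_of_locallyIntegrable hv) 0,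
    intervalIntegral.continuous_primitive (fun _ _ => hz.intervalIntegrable _ _) 0,
    fun hzero => hv0 ?_⟩
  filter_upwards [LocallyIntegrable.ae_hasDerivAt_integral hv] with t ht
  have hderiv := ht 0
  rw [hzero] at hderiv
  exact hderiv.unique (hasDerivAt_const t 0)

end NullTrajectory

section FormalNullSolution

variable {E F : Type*} [AddCommGroup E] [Module ℝ[X] E] [AddCommGroup F] [Module ℝ[X] F]
  {ω : Fin m → E} {ξ : Fin n → E}

/-- The equations of a null trajectory in a module over `ℝ[X]`, where the indeterminate acts as
integration from `0`. -/
def IsFormalNullSolution (S : LTISystem n m p) (ω : Fin m → E) (ξ : Fin n → E) : Prop :=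
  (∀ i, ξ i = (Polynomial.X : ℝ[X]) •
    (∑ j, Polynomial.C (S.A i j) • ξ j + ∑ j, Polynomial.C (S.B i j) • ω j)) ∧
  ∀ i, ∑ j, Polynomial.C (S.C i j) • ξ j + ∑ j, Polynomial.C (S.D i j) • ω j = 0

theorem isFormalNullSolution_comp_iff (φ : E →ₗ[ℝ[X]] F) (hφ : Function.Injective φ) :
    S.IsFormalNullSolution (φ ∘ ω) (φ ∘ ξ) ↔ S.IsFormalNullSolution ω ξ := by
  simp only [IsFormalNullSolution, Function.comp_apply, ← map_smul, ← map_sum, ← map_add,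
    hφ.eq_iff, map_eq_zero_iff φ hφ]

theorem IsFormalNullSolution.comp (h : S.IsFormalNullSolution ω ξ) (φ : E →ₗ[ℝ[X]] F) :
    S.IsFormalNullSolution (φ ∘ ω) (φ ∘ ξ) := by
  refine ⟨fun i => ?_, fun i => ?_⟩
  · simpa using congrArg φ (h.1 i)
  · simpa using congrArg φ (h.2 i)

theorem IsFormalNullSolution.exists_polynomial [Module.IsTorsionFree ℝ[X] E]
    (h : S.IsFormalNullSolution ω ξ) (hω : ω ≠ 0) :
    ∃ (P : Fin m → ℝ[X]) (Q : Fin n → ℝ[X]), S.IsFormalNullSolution P Q ∧ P ≠ 0 := by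
  obtain ⟨j, hj⟩ := Function.ne_iff.1 hω
  let M := Submodule.span ℝ[X] (range ω ∪ range ξ)
  have : Module.Finite ℝ[X] M :=
    Module.Finite.span_of_finite _ ((finite_range ω).union (finite_range ξ))
  let ω' (j : Fin m) : M := ⟨ω j, Submodule.subset_span (.inl ⟨j, rfl⟩)⟩
  let ξ' (j : Fin n) : M := ⟨ξ j, Submodule.subset_span (.inr ⟨j, rfl⟩)⟩
  have h' : S.IsFormalNullSolution ω' ξ' :=
    (isFormalNullSolution_comp_iff M.subtype M.injective_subtype).1 h
  -- `M` is finitely generated and torsion-free over a PID, hence free.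
  obtain ⟨l, hl⟩ : ∃ l : Module.Dual ℝ[X] M, l (ω' j) ≠ 0 := by
    by_contra! hall
    exact hj (congrArg Subtype.val ((Module.forall_dual_apply_eq_zero_iff ℝ[X] (ω' j)).1 hall))
  exact ⟨l ∘ ω', l ∘ ξ', h'.comp l, Function.ne_iff.2 ⟨j, hl⟩⟩

theorem isFormalNullSolution_volterra_iff {ω : Fin m → C(ℝ, ℝ)} {ξ : Fin n → C(ℝ, ℝ)} :
    S.IsFormalNullSolution (Module.AEval'.of (volterra ℝ) ∘ ω)
        (Module.AEval'.of (volterra ℝ) ∘ ξ) ↔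
      (∀ i, ξ i = volterra ℝ (∑ j, S.A i j • ξ j + ∑ j, S.B i j • ω j)) ∧
        ∀ i, ∑ j, S.C i j • ξ j + ∑ j, S.D i j • ω j = 0 := by
  simp only [IsFormalNullSolution, Function.comp_apply, Module.AEval.C_smul, ← map_smul,
    ← map_sum, ← map_add, Module.AEval'.X_smul_of, EmbeddingLike.apply_eq_iff_eq,
    EmbeddingLike.map_eq_zero_iff]

theorem isNullTrajectory_iff_isFormalNullSolution {ω : Fin m → C(ℝ, ℝ)} {ξ : Fin n → C(ℝ, ℝ)} :
    S.IsNullTrajectory (fun t i => ω i t) (fun t i => ξ i t) ↔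
      S.IsFormalNullSolution (Module.AEval'.of (volterra ℝ) ∘ ω)
        (Module.AEval'.of (volterra ℝ) ∘ ξ) := by
  have hcoord {q : ℕ} (M : Matrix (Fin q) (Fin n) ℝ) (N : Matrix (Fin q) (Fin m) ℝ) (t : ℝ)
      (i : Fin q) : (M *ᵥ (fun i => ξ i t) + N *ᵥ fun i => ω i t) i =
        (∑ j, M i j • ξ j + ∑ j, N i j • ω j) t := by
    simp [Matrix.mulVec, dotProduct]
  have hstate (t : ℝ) (i : Fin n) :
      (∫ s in (0 : ℝ)..t, (S.A *ᵥ (fun i => ξ i s) + S.B *ᵥ fun i => ω i s)) i =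
        volterra ℝ (∑ j, S.A i j • ξ j + ∑ j, S.B i j • ω j) t := by
    have hcont : Continuous fun s => S.A *ᵥ (fun i => ξ i s) + S.B *ᵥ fun i => ω i s := by fun_prop
    simp only [volterra_apply, ← hcoord]
    exact ((ContinuousLinearMap.proj (R := ℝ) i).intervalIntegral_comp_comm (μ := volume)
      (hcont.intervalIntegrable 0 t)).symm
  have hout : Continuous fun t => S.C *ᵥ (fun i => ξ i t) + S.D *ᵥ fun i => ω i t := by fun_prop
  rw [isFormalNullSolution_volterra_iff]
  refine ⟨fun h => ⟨fun i => ?_, fun i => ?_⟩, fun h => ⟨fun t => ?_, .of_forall fun t => ?_⟩⟩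
  · ext t
    exact (congrFun (h.state_eq t) i).trans (hstate t i)
  · have hzero := Measure.eq_of_ae_eq (μ := volume) h.output_eq_zero hout continuous_zero
    ext t
    rw [← hcoord]
    exact congrFun (congrFun hzero t) i
  · ext i
    rw [hstate, ← h.1]
  · ext i
    rw [hcoord, h.2]
    rfl

theorem IsInputRedundant.exists_polynomial_isFormalNullSolution {U : Set (Fin m → ℝ)}
    {X : Set (Fin n → ℝ)} (h : S.IsInputRedundant U X) :
    ∃ (P : Fin m → ℝ[X]) (Q : Fin n → ℝ[X]), S.IsFormalNullSolution P Q ∧ P ≠ 0 := by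
  obtain ⟨v, z, hvz, hv, hz, hv0⟩ := h.exists_continuous_isNullTrajectory
  let ω (j : Fin m) : C(ℝ, ℝ) := ⟨fun t => v t j, continuous_pi_iff.1 hv j⟩
  let ξ (j : Fin n) : C(ℝ, ℝ) := ⟨fun t => z t j, continuous_pi_iff.1 hz j⟩
  refine (isNullTrajectory_iff_isFormalNullSolution (ω := ω) (ξ := ξ)).1 hvz |>.exists_polynomial
    fun hzero => hv0 ?_
  ext t j
  have hj : ω j = 0 := (Module.AEval'.of (volterra ℝ)).map_eq_zero_iff.1 (congrFun hzero j)
  exact DFunLike.congr_fun hj t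

end FormalNullSolution

section NullPulse

variable {K : Set ℝ}

/-- A continuous null trajectory with nonzero input whose input and state both vanish outside `K`:
adding it to an input-state pair changes the input, but neither the output nor anything outside
`K`. -/
structure IsNullPulse (S : LTISystem n m p) (K : Set ℝ) (v : Signal m) (z : Signal n) : Prop
    extends S.IsNullTrajectory v z where
  continuous_input : Continuous v
  continuous_state : Continuous z
  input_ne_zero : v ≠ 0
  input_eq_zero : ∀ t ∉ K, v t = 0
  state_eq_zero : ∀ t ∉ K, z t = 0

theorem IsFormalNullSolution.exists_isNullPulse {P : Fin m → ℝ[X]} {Q : Fin n → ℝ[X]}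
    (h : S.IsFormalNullSolution P Q) (hP : P ≠ 0) (hK : (interior K).Nonempty) (h0 : 0 ∉ K) :
    ∃ v z, S.IsNullPulse K v z := by
  let d := (Finset.univ.sup fun j => (P j).natDegree) ⊔ Finset.univ.sup fun j => (Q j).natDegree
  obtain ⟨f, hf, hsupp⟩ := exists_volterra_pow_supported hK h0 d
  let φ := LinearMap.toSpanSingleton ℝ[X] _ (Module.AEval'.of (volterra ℝ) f)
  let ω (j : Fin m) : C(ℝ, ℝ) := Polynomial.aeval (volterra ℝ) (P j) f
  let ξ (j : Fin n) : C(ℝ, ℝ) := Polynomial.aeval (volterra ℝ) (Q j) f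
  have hφ (r : ℝ[X]) :
      φ r = Module.AEval'.of (volterra ℝ) (Polynomial.aeval (volterra ℝ) r f) :=
    (Module.AEval.of_aeval_smul ..).symm
  have hnull : S.IsNullTrajectory (fun t j => ω j t) fun t j => ξ j t := by
    rw [isNullTrajectory_iff_isFormalNullSolution]
    convert h.comp φ using 1 <;> exact funext fun j => (hφ _).symm
  refine ⟨_, _, hnull, by fun_prop, by fun_prop, fun hzero => hP ?_, fun t ht => ?_, fun t ht => ?_⟩
  · ext1 j
    have hω : ω j = 0 := by
      ext t
      exact congrFun (congrFun hzero t) j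
    by_contra hPj
    exact hf (eq_zero_of_aeval_volterra_eq_zero hPj hω)
  · ext j
    exact aeval_volterra_apply_eq_zero (fun i hi => hsupp i hi t ht)
      ((Finset.le_sup (f := fun j => (P j).natDegree) (Finset.mem_univ j)).trans le_sup_left)
  · ext j
    exact aeval_volterra_apply_eq_zero (fun i hi => hsupp i hi t ht)
      ((Finset.le_sup (f := fun j => (Q j).natDegree) (Finset.mem_univ j)).trans le_sup_right)

theorem exists_isNullPulse_zero_of_rho_pos (h : 0 < S.rho) (hK : (interior K).Nonempty) :
    ∃ v, S.IsNullPulse K v 0 := by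
  have := Module.nontrivial_of_finrank_pos h
  obtain ⟨⟨w, hwB, hwD⟩, hw⟩ := exists_ne
    (0 : ↥(LinearMap.ker S.B.mulVecLin ⊓ LinearMap.ker S.D.mulVecLin))
  obtain ⟨c, hc⟩ := hK
  obtain ⟨f, hsupp, -, hsmooth, -, hfc⟩ :=
    exists_contDiff_tsupport_subset (n := 0) (mem_interior_iff_mem_nhds.1 hc)
  have hcont : Continuous f := hsmooth.continuous
  have hB : S.B *ᵥ w = 0 := hwB
  have hD : S.D *ᵥ w = 0 := hwD
  refine ⟨fun t => f t • w, ⟨fun t => ?_, .of_forall fun t => ?_⟩, by fun_prop, continuous_zero,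
    fun hzero => hw (Subtype.ext ?_), fun t ht => ?_, fun _ _ => rfl⟩
  · simp [Matrix.mulVec_smul, hB]
  · simp [Matrix.mulVec_smul, hD]
  · simpa [hfc] using congrFun hzero c
  · simp [image_eq_zero_of_notMem_tsupport fun h => ht (hsupp h)]

theorem IsInputRedundant.exists_isNullPulse {U : Set (Fin m → ℝ)} {X : Set (Fin n → ℝ)}
    (h : S.IsInputRedundant U X) (hK : (interior K).Nonempty) (h0 : 0 ∉ K) :
    ∃ v z, S.IsNullPulse K v z ∧ (0 < S.rho → z = 0) := by
  by_cases hrho : 0 < S.rho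
  · obtain ⟨v, hv⟩ := exists_isNullPulse_zero_of_rho_pos hrho hK
    exact ⟨v, 0, hv, fun _ => rfl⟩
  · obtain ⟨P, Q, hPQ, hP⟩ := h.exists_polynomial_isFormalNullSolution
    obtain ⟨v, z, hvz⟩ := hPQ.exists_isNullPulse hP hK h0
    exact ⟨v, z, hvz, fun hpos => absurd hpos hrho⟩

theorem IsNullPulse.mem_unconstrainedTriples {v : Signal m} {z : Signal n}
    (h : S.IsNullPulse K v z) (hK : IsCompact K) (hpos : K ⊆ Ioi 0) :
    (v, z, 0) ∈ S.unconstrainedTriples 0 := by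
  have hneg (t : ℝ) (ht : t < 0) : v t = 0 := h.input_eq_zero t fun htK => (hpos htK).not_gt ht
  refine ⟨mem_inputSpace_of_hasCompactSupport h.continuous_input
    (.intro hK h.input_eq_zero) hneg, h.continuous_state.continuousOn,
    piecewiseContinuous_of_continuous continuous_zero,
    fun t _ => (h.state_eq t).trans (zero_add _).symm, ?_⟩
  exact ae_restrict_of_ae (h.output_eq_zero.mono fun t ht => ht.symm)

theorem IsNullPulse.mem_redundantPairs {U : Set (Fin m → ℝ)} {X : Set (Fin n → ℝ)}
    {x₀ : Fin n → ℝ} {u v : Signal m} {x z : Signal n} {y : Signal p} {c : ℝ}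
    (h : S.IsNullPulse K v z) (hK : IsCompact K) (hpos : K ⊆ Ioi 0)
    (huxy : (u, x, y) ∈ S.triples U X x₀) (hx₀ : x₀ ∈ X) (hc : c ≠ 0)
    (hU : ∀ t ∈ K, u t + c • v t ∈ U) (hX : ∀ t ∈ K, x t + c • z t ∈ X) :
    (x₀, y) ∈ S.redundantPairs U X := by
  have hsum := add_smul_mem_unconstrainedTriples huxy.1 (h.mem_unconstrainedTriples hK hpos) c
  rw [smul_zero, smul_zero, add_zero, add_zero] at hsum
  obtain ⟨⟨huU, -⟩, ⟨hxX, -⟩, hy⟩ := huxy.2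
  have huU' (t : ℝ) (ht : 0 ≤ t) : (u + c • v) t ∈ U := by
    by_cases htK : t ∈ K
    · exact hU t htK
    · simpa [h.input_eq_zero t htK] using huU t ht
  have hxX' (t : ℝ) (ht : 0 ≤ t) : (x + c • z) t ∈ X := by
    by_cases htK : t ∈ K
    · exact hX t htK
    · simpa [h.state_eq_zero t htK] using hxX t ht
  refine ⟨⟨hx₀, hy⟩, _, y, _, y, ⟨x, huxy⟩,
    ⟨x + c • z, hsum, ⟨huU', hsum.1⟩, ⟨hxX', hsum.2.1⟩, hy⟩, fun heq => h.input_ne_zero ?_,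
    .of_forall fun _ => rfl, .of_forall fun _ => rfl⟩
  refine Measure.eq_of_ae_eq (μ := volume) ?_ h.continuous_input continuous_zero
  filter_upwards [(ae_restrict_iff' measurableSet_Ici).1 heq] with t ht
  by_cases htK : t ∈ K
  · simpa [hc] using ht (mem_Ici.2 (hpos htK).le)
  · exact h.input_eq_zero t htK

end NullPulse

end LTISystem

theorem theorem1 {n m p : ℕ} (S : LTISystem n m p)
    (hS : S.IsInputRedundant Set.univ Set.univ)
    (U : Set (Fin m → ℝ)) (X : Set (Fin n → ℝ))
    (x₀ : Fin n → ℝ) (y : Signal p)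
    (hadm : (x₀, y) ∈ S.admissiblePairs U X)
    (hwindow : ∃ (u : Signal m) (x : Signal n) (t₀ tf : ℝ), 0 ≤ t₀ ∧ t₀ < tf ∧
      (u, x, y) ∈ S.triples U X x₀ ∧
      (0 < S.rho → ∀ t ∈ Set.Ioo t₀ tf, u t ∈ interior U) ∧
      (S.rho = 0 → ∀ t ∈ Set.Ioo t₀ tf, u t ∈ interior U ∧ x t ∈ interior X)) :
    (x₀, y) ∈ S.redundantPairs U X := by
  obtain ⟨u, x, t₀, tf, ht₀, htf, huxy, hrho_pos, hrho_zero⟩ := hwindow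
  obtain ⟨K, hKsub, hK, hKint, huK⟩ := huxy.1.1.2.1.exists_isCompact_continuousOn ht₀ htf
  have hpos : K ⊆ Ioi 0 := fun t ht => ht₀.trans_lt (hKsub ht).1
  have hxK : ContinuousOn x K := huxy.1.2.1.mono (hpos.trans Ioi_subset_Ici_self)
  obtain ⟨v, z, hpulse, hz⟩ := hS.exists_isNullPulse hKint fun h0 => (mem_Ioi.1 (hpos h0)).false
  have hu_int (t : ℝ) (ht : t ∈ K) : u t ∈ interior U :=
    S.rho.eq_zero_or_pos.elim (fun hrho => (hrho_zero hrho t (hKsub ht)).1)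
      fun hrho => hrho_pos hrho t (hKsub ht)
  have hU := eventually_forall_add_smul_mem hK huK hpulse.continuous_input.continuousOn hu_int
  have hX : ∀ᶠ c in 𝓝 (0 : ℝ), ∀ t ∈ K, x t + c • z t ∈ X := by
    rcases S.rho.eq_zero_or_pos with hrho | hrho
    · exact eventually_forall_add_smul_mem hK hxK hpulse.continuous_state.continuousOn
        fun t ht => (hrho_zero hrho t (hKsub ht)).2
    · refine .of_forall fun c t ht => ?_
      simpa [hz hrho] using huxy.2.2.1.1 t (hpos ht).le
  obtain ⟨c, ⟨hcU, hcX⟩, hc⟩ := (((hU.and hX).filter_mono nhdsWithin_le_nhds).and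
    (self_mem_nhdsWithin : ∀ᶠ c in 𝓝[≠] (0 : ℝ), c ≠ 0)).exists
  exact hpulse.mem_redundantPairs hK hpos huxy hadm.1.1 hc hcU hcX
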